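/- For a convex compact set $K\subset\mathbb{R}^n$ and a unit vector $q\in\mathbb{R}^n$, let $P_q$ be the orthogonal projection of $\mathbb{R}^n$ onto $\{z : \langle q,z\rangle=0\}$, and let $f_{K,q}:P_qK\to\mathbb{R}$, $f_{K,q}(x)=\min\{\mu\in\mathbb{R} : x+\mu q\in K\}$. The convex compact set $K$ is called a P-set if $f_{K,q}$ is continuous on $P_qK$ for every unit vector $q$. Theorem. Let $A,B\subset\mathbb{R}^n$ be closed convex sets such that the Minkowski sum $C=A+B$ is a P-set. Then there exist continuous functions $a:C\to A$ and $b:C\to B$ with $a(c)+b(c)=c$ for all $c\in C$. -/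

import Mathlib

open scoped Pointwise

/-- `shadow q A` is the image of `A` under the orthogonal projection of `ℝⁿ` onto the
hyperplane of vectors orthogonal to `q`. -/
noncomputable def shadow {n : ℕ} (q : EuclideanSpace ℝ (Fin n))
    (A : Set (EuclideanSpace ℝ (Fin n))) : Set (EuclideanSpace ℝ (Fin n)) :=
  (fun z => (Submodule.span ℝ {q})ᗮ.starProjection z) '' A

/-- The function `x ↦ min {μ | x + μ q ∈ A}`; for compact `A` it is used at points `x` of
`shadow q A`, where the minimum is attained (see `isLeast_lowerBoundary`). -/
noncomputable def lowerBoundary {n : ℕ} (A : Set (EuclideanSpace ℝ (Fin n)))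
    (q x : EuclideanSpace ℝ (Fin n)) : ℝ :=
  sInf {μ : ℝ | x + μ • q ∈ A}

theorem isLeast_lowerBoundary {n : ℕ} {A : Set (EuclideanSpace ℝ (Fin n))} (hA : IsCompact A)
    {q x : EuclideanSpace ℝ (Fin n)} (hq : ‖q‖ = 1) (hx : x ∈ shadow q A) :
    IsLeast {μ : ℝ | x + μ • q ∈ A} (lowerBoundary A q x) := by
  have hcl : IsClosed {μ : ℝ | x + μ • q ∈ A} :=
    hA.isClosed.preimage (by fun_prop : Continuous fun μ : ℝ => x + μ • q)
  have hne : {μ : ℝ | x + μ • q ∈ A}.Nonempty := by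
    obtain ⟨z, hz, rfl⟩ := hx
    refine ⟨inner ℝ q z, ?_⟩
    have h1 := Submodule.starProjection_unit_singleton ℝ hq z
    have h2 := Submodule.starProjection_add_starProjection_orthogonal
      (K := Submodule.span ℝ {q}) z
    rw [h1] at h2
    change _ ∈ A
    rw [add_comm, h2]
    exact hz
  have hbd : BddBelow {μ : ℝ | x + μ • q ∈ A} := by
    obtain ⟨R, hR⟩ := hA.isBounded.exists_norm_le
    refine ⟨-(R + ‖x‖), fun μ hμ => ?_⟩
    have h3 : ‖μ • q‖ ≤ R + ‖x‖ := by
      have h4 := norm_sub_le (x + μ • q) x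
      rw [add_sub_cancel_left] at h4
      linarith [hR _ hμ]
    rw [norm_smul, hq, mul_one, Real.norm_eq_abs] at h3
    linarith [neg_abs_le μ]
  exact ⟨hcl.csInf_mem hne hbd, fun μ hμ => csInf_le hbd hμ⟩

/-- A P-set in `ℝⁿ`: a convex compact set such that for every unit vector `q` the function
`x ↦ min {μ | x + μ q ∈ A}` is continuous on the projection of `A` along `q`. -/
structure IsPSet {n : ℕ} (A : Set (EuclideanSpace ℝ (Fin n))) : Prop where
  convex : Convex ℝ A
  isCompact : IsCompact A
  continuousOn_lowerBoundary : ∀ q : EuclideanSpace ℝ (Fin n), ‖q‖ = 1 →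
    ContinuousOn (lowerBoundary A q) (shadow q A)

open Filter Topology Set Metric

/-!
A continuous choice of `a` (the point of least norm in `{a ∈ A | c - a ∈ B}`) exists as soon as
addition `A × B → C` is an open map, i.e. its fibres are lower hemicontinuous. The P-set condition
says that the projection of `C` along any line is open onto its image; by compactness of the fibres
the same holds for every linear map `ℓ` on `C`.

Given `c ∈ C`, choose `ℓ` whose kernel is the direction of the smallest face of `C` containing `c`.
Then `ℓ c` is an extreme point of `ℓ C`, and `C` contains a ball around `c` inside the fibre of `ℓ`.
Over an extreme point of `ℓ C` the fibre of `(a, b) ↦ ℓ (a + b)` is a product of two convex sets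
whose sum is the fibre of `ℓ` on `C`, so openness of `ℓ` on `C` passes to each factor by
cancellation. This gives openness of `(a, b) ↦ ℓ (a + b)` over the extreme points, which suffices by
Krein–Milman, and the ball in the fibre turns it into openness of addition itself over `c`.
-/

/-- The fibre of `f : s → f '' s` over `y`, as a set-valued function of `y`. Its lower
hemicontinuity on `f '' s` says that `f : s → f '' s` is an open map. -/
def fiberOn {X Y : Type*} (f : X → Y) (s : Set X) (y : Y) : Set X :=
  s ∩ f ⁻¹' {y}

theorem fiberOn_image {X Y Z : Type*} {f : X → Y} {g : Y → Z} {s : Set X} {z : Z} :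
    fiberOn g (f '' s) z = f '' fiberOn (g ∘ f) s z :=
  (image_inter_preimage f s (g ⁻¹' {z})).symm

section Hemicontinuity

variable {X Y Z : Type*} [TopologicalSpace X]

section TopologicalSpace

variable [TopologicalSpace Y] [TopologicalSpace Z] {s : Set X} {x : X}

theorem lowerHemicontinuousWithinAt_iff_forall_mem_nhds {Φ : X → Set Y} :
    LowerHemicontinuousWithinAt Φ s x ↔
      ∀ y ∈ Φ x, ∀ N ∈ 𝓝 y, ∀ᶠ x' in 𝓝[s] x, (Φ x' ∩ N).Nonempty := by
  rw [lowerHemicontinuousWithinAt_iff]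
  constructor
  · intro h y hy N hN
    obtain ⟨U, hUN, hU, hyU⟩ := mem_nhds_iff.1 hN
    exact (h U hU ⟨y, hy, hyU⟩).mono fun _ h => h.mono (inter_subset_inter_right _ hUN)
  · rintro h U hU ⟨y, hy, hyU⟩
    exact h y hy U (hU.mem_nhds hyU)

theorem lowerHemicontinuousWithinAt_image {Φ : X → Set Y} {g : Y → Z}
    (hΦ : LowerHemicontinuousWithinAt Φ s x) (hg : Continuous g) :
    LowerHemicontinuousWithinAt (fun x => g '' Φ x) s x := by
  rw [lowerHemicontinuousWithinAt_iff] at hΦ ⊢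
  intro U hU h
  simp only [image_inter_nonempty_iff] at h ⊢
  exact hΦ _ (hU.preimage hg) h

theorem lowerHemicontinuousWithinAt_prod {Φ : X → Set Y} {Ψ : X → Set Z}
    (hΦ : LowerHemicontinuousWithinAt Φ s x) (hΨ : LowerHemicontinuousWithinAt Ψ s x) :
    LowerHemicontinuousWithinAt (fun x => Φ x ×ˢ Ψ x) s x := by
  rw [lowerHemicontinuousWithinAt_iff_forall_mem_nhds] at *
  rintro ⟨y, z⟩ ⟨hy, hz⟩ N hN
  obtain ⟨U, hU, V, hV, hUV⟩ := mem_nhds_prod_iff.1 hN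
  filter_upwards [hΦ y hy U hU, hΨ z hz V hV] with x' h₁ h₂
  refine (h₁.prod h₂).mono ?_
  rw [← prod_inter_prod]
  exact inter_subset_inter_right _ hUV

theorem upperHemicontinuous_image {Φ : X → Set Y} {g : Y → Z} (hΦ : UpperHemicontinuous Φ)
    (hg : Continuous g) : UpperHemicontinuous fun x => g '' Φ x := by
  rw [upperHemicontinuous_iff_forall_isOpen] at hΦ ⊢
  intro x U hU h
  simp only [image_subset_iff] at h ⊢
  exact hΦ x _ (hU.preimage hg) h

theorem upperHemicontinuous_of_isClosed_graph {Φ : X → Set Y} {K : Set Y} (hK : IsCompact K)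
    (hΦK : ∀ x, Φ x ⊆ K) (hΦ : IsClosed {p : X × Y | p.2 ∈ Φ p.1}) :
    UpperHemicontinuous Φ := by
  rw [upperHemicontinuous_iff_forall_isOpen]
  intro x U hU hxU
  have hloc : ∀ y ∈ K, ∀ᶠ p : X × Y in 𝓝 (x, y), p.2 ∈ Φ p.1 → p.2 ∈ U := by
    intro y _
    by_cases hy : y ∈ Φ x
    · filter_upwards [continuousAt_snd.preimage_mem_nhds (hU.mem_nhds (hxU hy))] with p hp _
      exact hp
    · filter_upwards [hΦ.isOpen_compl.mem_nhds (x := (x, y)) hy] with p hp h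
      exact absurd h hp
  have hunif : ∀ᶠ x' in 𝓝 x, ∀ y ∈ K, y ∈ Φ x' → y ∈ U :=
    hK.eventually_forall_of_forall_eventually hloc
  filter_upwards [hunif] with x' h y hy
  exact h y (hΦK x' hy) hy

theorem upperHemicontinuous_fiberOn [T2Space X] {f : Y → X} {D : Set Y} (hD : IsCompact D)
    (hD' : IsClosed D) (hf : Continuous f) : UpperHemicontinuous (fiberOn f D) :=
  upperHemicontinuous_of_isClosed_graph hD (fun _ => inter_subset_left)
    ((hD'.preimage continuous_snd).inter
      (isClosed_eq (hf.comp continuous_snd) continuous_fst))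

end TopologicalSpace

theorem eventually_subset_thickening_of_lowerHemicontinuousWithinAt [PseudoMetricSpace Y]
    {Γ : X → Set Y} {s : Set X} {x : X} {K : Set Y} (hΓ : LowerHemicontinuousWithinAt Γ s x)
    (hK : IsCompact K) (hKΓ : K ⊆ Γ x) {δ : ℝ} (hδ : 0 < δ) :
    ∀ᶠ x' in 𝓝[s] x, K ⊆ thickening δ (Γ x') := by
  obtain ⟨t, htK, ht, hcover⟩ := hK.finite_cover_balls (half_pos hδ)
  have hmeet : ∀ᶠ x' in 𝓝[s] x, ∀ y ∈ t, (Γ x' ∩ ball y (δ / 2)).Nonempty :=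
    (eventually_all_finite ht).2 fun y hy =>
      lowerHemicontinuousWithinAt_iff_forall_mem_nhds.1 hΓ y (hKΓ (htK hy)) _
        (ball_mem_nhds y (half_pos hδ))
  filter_upwards [hmeet] with x' h z hz
  obtain ⟨y, hy, hzy⟩ := mem_iUnion₂.1 (hcover hz)
  obtain ⟨w, hw, hwy⟩ := h y hy
  refine mem_thickening_iff.2 ⟨w, hw, ?_⟩
  linarith [dist_triangle_right z w y, mem_ball.1 hzy, mem_ball.1 hwy]

variable {E : Type*} [NormedAddCommGroup E] [NormedSpace ℝ E] [StrictConvexSpace ℝ E]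

theorem eq_of_isMinOn_norm {s : Set E} (hs : Convex ℝ s) {x y : E} (hx : x ∈ s) (hy : y ∈ s)
    (hxs : IsMinOn norm s x) (hys : IsMinOn norm s y) : x = y := by
  have hxy : ‖x‖ = ‖y‖ := le_antisymm (hxs hy) (hys hx)
  by_contra hne
  have hlt : ‖(1 / 2 : ℝ) • (x + y)‖ < ‖x‖ := (norm_midpoint_lt_iff hxy).2 hne
  rw [smul_add] at hlt
  exact hlt.not_ge (hxs (hs hx hy (by norm_num) (by norm_num) (by norm_num)))

theorem exists_continuous_selection {Φ : X → Set E} (hlower : LowerHemicontinuous Φ)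
    (hupper : UpperHemicontinuous Φ) (hcompact : ∀ x, IsCompact (Φ x))
    (hconvex : ∀ x, Convex ℝ (Φ x)) (hne : ∀ x, (Φ x).Nonempty) :
    ∃ a : X → E, Continuous a ∧ ∀ x, a x ∈ Φ x := by
  choose a haΦ hmin using fun x =>
    (hcompact x).exists_isMinOn (hne x) continuous_norm.continuousOn
  refine ⟨a, continuous_iff_continuousAt.2 fun x => ?_, haΦ⟩
  rw [ContinuousAt, (nhds_basis_opens (a x)).tendsto_right_iff]
  rintro N ⟨haN, hN⟩
  obtain ⟨s, has, hs⟩ : ∃ s, ‖a x‖ < s ∧ Φ x ⊆ N ∪ {y | s < ‖y‖} := by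
    rcases (Φ x \ N).eq_empty_or_nonempty with hempty | hnonempty
    · exact ⟨‖a x‖ + 1, lt_add_one _, (sdiff_eq_empty.1 hempty).trans subset_union_left⟩
    obtain ⟨b, ⟨hbΦ, hbN⟩, hbmin⟩ :=
      ((hcompact x).diff hN).exists_isMinOn hnonempty continuous_norm.continuousOn
    have hab : ‖a x‖ < ‖b‖ := by
      refine lt_of_le_of_ne (hmin x hbΦ) fun hab => hbN ?_
      have hb : IsMinOn norm (Φ x) b := fun y hy => hab ▸ hmin x hy
      exact eq_of_isMinOn_norm (hconvex x) (haΦ x) hbΦ (hmin x) hb ▸ haN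
    obtain ⟨s, has, hsb⟩ := exists_between hab
    exact ⟨s, has, fun y hy => or_iff_not_imp_left.2 fun hyN => hsb.trans_le (hbmin ⟨hy, hyN⟩)⟩
  have hsmall : ∀ᶠ x' in 𝓝 x, (Φ x' ∩ ball 0 s).Nonempty :=
    lowerHemicontinuousAt_iff.1 (hlower x) _ isOpen_ball ⟨a x, haΦ x, by simpa using has⟩
  have hlarge : ∀ᶠ x' in 𝓝 x, Φ x' ⊆ N ∪ {y | s < ‖y‖} :=
    upperHemicontinuous_iff_forall_isOpen.1 hupper x _
      (hN.union (isOpen_lt continuous_const continuous_norm)) hs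
  filter_upwards [hsmall, hlarge] with x' ⟨y, hyΦ, hys⟩ hsub
  have hlt : ‖a x'‖ < s := (hmin x' hyΦ).trans_lt (by simpa using hys)
  exact (hsub (haΦ x')).resolve_right hlt.not_gt

end Hemicontinuity

section Cancellation

variable {E : Type*} [AddCommGroup E] [Module ℝ E] [TopologicalSpace E] [IsTopologicalAddGroup E]
  [ContinuousSMul ℝ E] [LocallyConvexSpace ℝ E]

theorem subset_closure_of_add_subset_add {s t k : Set E} (ht : Convex ℝ t) (hk : IsCompact k)
    (hkne : k.Nonempty) (h : s + k ⊆ t + k) : s ⊆ closure t := by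
  intro x hx
  by_contra hxt
  obtain ⟨f, u, hfu, hux⟩ := geometric_hahn_banach_closed_point ht.closure isClosed_closure hxt
  obtain ⟨z, hz, hmax⟩ := hk.exists_isMaxOn hkne f.continuous.continuousOn
  obtain ⟨y, hy, w, hw, hyw : y + w = x + z⟩ := h (add_mem_add hx hz)
  have hsum : f y + f w = f x + f z := by rw [← map_add, hyw, map_add]
  have hwz : f w ≤ f z := hmax hw
  linarith [hfu y (subset_closure hy)]

end Cancellation

theorem isCompact_convexHull {E : Type*} [AddCommGroup E] [Module ℝ E] [FiniteDimensional ℝ E]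
    [TopologicalSpace E] [ContinuousAdd E] [ContinuousSMul ℝ E] {s : Set E} (hs : IsCompact s) :
    IsCompact (convexHull ℝ s) := by
  let combine (m : ℕ) (p : (Fin m → ℝ) × (Fin m → E)) : E := ∑ i, p.1 i • p.2 i
  have hcompact (m : ℕ) :
      IsCompact (combine m '' stdSimplex ℝ (Fin m) ×ˢ univ.pi fun _ => s) :=
    ((isCompact_stdSimplex ℝ (Fin m)).prod (isCompact_univ_pi fun _ => hs)).image (by fun_prop)
  have hunion : convexHull ℝ s = ⋃ m ∈ Finset.range (Module.finrank ℝ E + 2),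
      combine m '' stdSimplex ℝ (Fin m) ×ˢ univ.pi fun _ => s := by
    refine Subset.antisymm (fun x hx => ?_) (iUnion₂_subset fun m _ => ?_)
    · obtain ⟨ι, _, z, w, hzs, hz, hw, hw1, rfl⟩ := eq_pos_convex_span_of_mem_convexHull hx
      have hcard : Fintype.card ι < Module.finrank ℝ E + 2 :=
        Nat.lt_succ_of_le (hz.card_le_finrank_succ.trans
          (Nat.succ_le_succ (Submodule.finrank_le _)))
      let e := (Fintype.equivFin ι).symm
      refine mem_iUnion₂.2 ⟨_, Finset.mem_range.2 hcard, (w ∘ e, z ∘ e), ⟨⟨?_, ?_⟩, ?_⟩, ?_⟩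
      · exact fun i => (hw _).le
      · exact (e.sum_comp w).trans hw1
      · exact fun i _ => hzs (mem_range_self _)
      · exact e.sum_comp fun i => w i • z i
    · rintro _ ⟨⟨w, z⟩, ⟨⟨hw, hw1⟩, hz⟩, rfl⟩
      exact (convex_convexHull ℝ s).sum_mem (fun i _ => hw i) hw1
        fun i _ => subset_convexHull ℝ s (hz i (mem_univ i))
  rw [hunion]
  exact (Finset.range _).isCompact_biUnion fun m _ => hcompact m

theorem eq_and_eq_of_add_mem_extremePoints_add {E : Type*} [AddCommGroup E] [Module ℝ E]
    {s t : Set E} {a a' b b' : E} (ha : a ∈ s) (ha' : a' ∈ s) (hb : b ∈ t) (hb' : b' ∈ t)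
    (h : a + b ∈ (s + t).extremePoints ℝ) (hab : a' + b' = a + b) : a' = a ∧ b' = b := by
  have hmid : a + b ∈ openSegment ℝ (a + b') (a' + b) := by
    refine ⟨1 / 2, 1 / 2, by norm_num, by norm_num, by norm_num, ?_⟩
    calc (1 / 2 : ℝ) • (a + b') + (1 / 2 : ℝ) • (a' + b)
        = (1 / 2 : ℝ) • (a + b) + (1 / 2 : ℝ) • (a' + b') := by module
      _ = a + b := by rw [hab]; module
  obtain ⟨hb', ha'⟩ := (mem_extremePoints.1 h).2 _ (add_mem_add ha hb') _ (add_mem_add ha' hb) hmid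
  exact ⟨add_right_cancel ha', add_left_cancel hb'⟩

section Summands

variable {X E : Type*} [TopologicalSpace X] [SeminormedAddCommGroup E] [NormedSpace ℝ E]

theorem lowerHemicontinuousWithinAt_of_add {Γ Φ Ψ : X → Set E} {s : Set X} {x : X}
    (hΓ : LowerHemicontinuousWithinAt Γ s x) (hΨ : UpperHemicontinuousWithinAt Ψ s x)
    (hΦ : ∀ x' ∈ s, Convex ℝ (Φ x')) (hΨx : IsCompact (Ψ x)) (hΨne : (Ψ x).Nonempty)
    (hsub : Φ x + Ψ x ⊆ Γ x) (hsup : ∀ x' ∈ s, Γ x' ⊆ Φ x' + Ψ x') :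
    LowerHemicontinuousWithinAt Φ s x := by
  rw [lowerHemicontinuousWithinAt_iff_forall_mem_nhds]
  intro a ha N hN
  obtain ⟨ε, hε, hεN⟩ := Metric.mem_nhds_iff.1 hN
  obtain ⟨δ, hδ, hδε⟩ : ∃ δ, 0 < δ ∧ δ + δ < ε := ⟨ε / 3, by positivity, by linarith⟩
  have hlower : ∀ᶠ x' in 𝓝[s] x, {a} + Ψ x ⊆ thickening δ (Γ x') :=
    eventually_subset_thickening_of_lowerHemicontinuousWithinAt hΓ (isCompact_singleton.add hΨx)
      ((add_subset_add_right (singleton_subset_iff.2 ha)).trans hsub) hδ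
  have hupper : ∀ᶠ x' in 𝓝[s] x, Ψ x' ⊆ thickening δ (Ψ x) :=
    hΨ.forall_isOpen _ isOpen_thickening (self_subset_thickening hδ _)
  filter_upwards [hlower, hupper, self_mem_nhdsWithin] with x' hl hu hx'
  have hadd : {a} + Ψ x ⊆ thickening (δ + δ) (Φ x') + Ψ x :=
    calc {a} + Ψ x ⊆ thickening δ (Γ x') := hl
      _ ⊆ thickening δ (Φ x' + thickening δ (Ψ x)) :=
        thickening_subset_of_subset _ ((hsup x' hx').trans (add_subset_add_left hu))
      _ = thickening (δ + δ) (Φ x') + Ψ x := by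
        rw [← thickening_thickening hδ hδ]
        simp only [← add_ball_zero]
        abel
  have hclosure : a ∈ closure (thickening (δ + δ) (Φ x')) :=
    subset_closure_of_add_subset_add ((hΦ x' hx').thickening _) hΨx hΨne hadd rfl
  obtain ⟨b, hb, hab⟩ := mem_thickening_iff.1
    (cthickening_subset_thickening' hε hδε _ (closure_thickening_subset_cthickening _ _ hclosure))
  exact ⟨b, hb, hεN (mem_ball'.2 hab)⟩

end Summands

section ExtremePointTest

variable {G F : Type*} [NormedAddCommGroup G] [NormedSpace ℝ G] [NormedAddCommGroup F]
  [NormedSpace ℝ F] {D : Set G} {y : F}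

theorem fiberOn_convexHull_union_subset_of_mem_extremePoints {s t : Set G} {ψ : G →L[ℝ] F}
    (hD : Convex ℝ D) (hy : y ∈ (ψ '' D).extremePoints ℝ) (hs : Convex ℝ s) (hsD : s ⊆ D)
    (htD : t ⊆ D) (hty : ∀ x ∈ t, ψ x ≠ y) : fiberOn ψ (convexHull ℝ (s ∪ t)) y ⊆ s := by
  have hconvex : Convex ℝ {x ∈ D | ψ x = y → x ∈ s} := by
    rw [convex_iff_openSegment_subset]
    intro p hp q hq m hm
    refine ⟨hD.openSegment_subset hp.1 hq.1 hm, fun hmy => hs.openSegment_subset ?_ ?_ hm⟩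
    all_goals
      have hseg : y ∈ openSegment ℝ (ψ p) (ψ q) := by
        rw [← hmy, ← ContinuousLinearMap.coe_coe, ← LinearMap.coe_toAffineMap,
          ← image_openSegment]
        exact mem_image_of_mem _ hm
      have hpq := (mem_extremePoints.1 hy).2 _ (mem_image_of_mem ψ hp.1) _
        (mem_image_of_mem ψ hq.1) hseg
    · exact hp.2 hpq.1
    · exact hq.2 hpq.2
  have hgen : s ∪ t ⊆ {x ∈ D | ψ x = y → x ∈ s} :=
    union_subset (fun x hx => ⟨hsD hx, fun _ => hx⟩)
      fun x hx => ⟨htD hx, fun h => absurd h (hty x hx)⟩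
  exact fun x hx => (convexHull_min hgen hconvex hx.1).2 hx.2

variable [FiniteDimensional ℝ G]

theorem image_convexHull_eq_of_extremePoints_subset {s : Set G} {ψ : G →L[ℝ] F}
    (hD : IsCompact D) (hDc : Convex ℝ D) (hs : IsCompact s) (hsD : s ⊆ D)
    (h : (ψ '' D).extremePoints ℝ ⊆ ψ '' s) : ψ '' convexHull ℝ s = ψ '' D := by
  refine (image_mono (convexHull_min hsD hDc)).antisymm ?_
  rw [← closure_convexHull_extremePoints (hD.image ψ.continuous) (hDc.linear_image ψ.toLinearMap)]
  refine closure_minimal (convexHull_min (h.trans (image_mono (subset_convexHull ℝ s))) ?_) ?_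
  · exact (convex_convexHull ℝ s).linear_image ψ.toLinearMap
  · exact ((isCompact_convexHull hs).image ψ.continuous).isClosed

theorem lowerHemicontinuousWithinAt_fiberOn_of_extremePoints {ψ : G →L[ℝ] F} (hD : IsCompact D)
    (hDc : Convex ℝ D) (hy : y ∈ (ψ '' D).extremePoints ℝ)
    (h : LowerHemicontinuousWithinAt (fiberOn ψ D) ((ψ '' D).extremePoints ℝ) y) :
    LowerHemicontinuousWithinAt (fiberOn ψ D) (ψ '' D) y := by
  rw [lowerHemicontinuousWithinAt_iff_forall_mem_nhds] at h ⊢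
  intro d hd N hN
  obtain ⟨ε, hε, hεN⟩ := nhds_basis_closedBall.mem_iff.1 (interior_mem_nhds.2 hN)
  obtain ⟨O, hO, hyO, hOext⟩ := mem_nhdsWithin.1 (h d hd _ (closedBall_mem_nhds d hε))
  -- Away from `O` keep all of `D`; over `O` keep only points near `d`. Since `y` is extreme, the
  -- convex hull has no other points over `y`, and it still maps onto `ψ '' D` by Krein–Milman.
  set near := D ∩ closedBall d ε
  set far := D \ ψ ⁻¹' O
  have hnear : near ⊆ D := inter_subset_left
  have hfar : far ⊆ D := sdiff_subset
  have hcompact : IsCompact (near ∪ far) :=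
    (hD.inter_right isClosed_closedBall).union (hD.diff (hO.preimage ψ.continuous))
  have himage : ψ '' convexHull ℝ (near ∪ far) = ψ '' D := by
    refine image_convexHull_eq_of_extremePoints_subset hD hDc hcompact
      (union_subset hnear hfar) fun e he => ?_
    by_cases heO : e ∈ O
    · obtain ⟨x, ⟨hxD, hxe⟩, hxε⟩ := hOext ⟨heO, he⟩
      exact ⟨x, .inl ⟨hxD, hxε⟩, hxe⟩
    · obtain ⟨x, hxD, rfl⟩ := extremePoints_subset he
      exact ⟨x, .inr ⟨hxD, heO⟩, rfl⟩
  have hfiber : fiberOn ψ (convexHull ℝ (near ∪ far)) y ⊆ interior N :=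
    (fiberOn_convexHull_union_subset_of_mem_extremePoints hDc hy
      (hDc.inter (convex_closedBall d ε)) hnear hfar
      fun x hx hxy => hx.2 (mem_preimage.2 (hxy ▸ hyO))).trans (inter_subset_right.trans hεN)
  have hhull := isCompact_convexHull hcompact
  filter_upwards [nhdsWithin_le_nhds ((upperHemicontinuous_fiberOn hhull hhull.isClosed
    ψ.continuous).forall_isOpen y _ isOpen_interior hfiber), self_mem_nhdsWithin] with y' hsub hy'
  obtain ⟨x, hx, hxy⟩ := himage ▸ hy'
  exact ⟨x, ⟨convexHull_min (union_subset hnear hfar) hDc hx, hxy⟩,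
    interior_subset (hsub ⟨hx, hxy⟩)⟩

end ExtremePointTest

section Faces

theorem exists_forall_mem_span_of_neg_mem {E : Type*} [NormedAddCommGroup E] [NormedSpace ℝ E]
    [FiniteDimensional ℝ E] {s : Set E} (hs : Convex ℝ s) (h0 : 0 ∈ s) (hneg : ∀ v ∈ s, -v ∈ s) :
    ∃ r > 0, ∀ v ∈ Submodule.span ℝ s, ‖v‖ ≤ r → v ∈ s := by
  let S : Set (Submodule.span ℝ s) := (↑) ⁻¹' s
  have hS : Convex ℝ S := hs.linear_preimage (Submodule.span ℝ s).subtype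
  have haffine : affineSpan ℝ S = ⊤ := by
    refine SetLike.coe_injective ?_
    rw [← insert_eq_of_mem (show (0 : Submodule.span ℝ s) ∈ S from h0), affineSpan_insert_zero,
      Submodule.span_span_coe_preimage]
    rfl
  obtain ⟨x, hx⟩ := hS.interior_nonempty_iff_affineSpan_eq_top.2 haffine
  have hzero : (0 : Submodule.span ℝ s) ∈ interior S :=
    hS.openSegment_interior_self_subset_interior hx
      (show -x ∈ S from hneg _ (interior_subset (s := S) hx))
      ⟨1 / 2, 1 / 2, by norm_num, by norm_num, by norm_num, by simp⟩
  obtain ⟨r, hr, hrS⟩ := nhds_basis_closedBall.mem_iff.1 (mem_interior_iff_mem_nhds.1 hzero)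
  exact ⟨r, hr, fun v hv hvr => hrS (mem_closedBall_zero_iff.2 hvr : (⟨v, hv⟩ : _) ∈ _)⟩

/-- The direction of the smallest face of the convex set `C` that contains `c`: it is spanned by
the vectors along which one can move a little from `c` both ways inside `C`. -/
def faceDirection {E : Type*} [AddCommGroup E] [Module ℝ E] (C : Set E) (c : E) :
    Submodule ℝ E :=
  Submodule.span ℝ {v | c + v ∈ C ∧ c - v ∈ C}

section Algebraic

variable {E : Type*} [AddCommGroup E] [Module ℝ E] {C : Set E} {c : E}

theorem sub_mem_faceDirection_of_mem_openSegment (hC : Convex ℝ C) {p q : E} (hp : p ∈ C)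
    (hq : q ∈ C) (h : c ∈ openSegment ℝ p q) : p - q ∈ faceDirection C c := by
  obtain ⟨α, β, hα, hβ, hαβ, rfl⟩ := h
  have hmove : (α * β) • (p - q) ∈ faceDirection C (α • p + β • q) := by
    refine Submodule.subset_span ⟨?_, ?_⟩
    · convert hC hp hq (a := α * (1 + β)) (b := β * (1 - α)) (by positivity) ?_ ?_ using 1
      · module
      · nlinarith
      · linear_combination hαβ
    · convert hC hp hq (a := α * (1 - β)) (b := β * (1 + α)) ?_ (by positivity) ?_ using 1
      · module
      · nlinarith
      · linear_combination hαβ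
  rwa [Submodule.smul_mem_iff _ (by positivity)] at hmove

theorem faceDirection_le_of_mem_openSegment (hC : Convex ℝ C) {m c' : E} (hc' : c' ∈ C)
    (h : c ∈ openSegment ℝ m c') : faceDirection C m ≤ faceDirection C c := by
  obtain ⟨α, β, hα, hβ, hαβ, rfl⟩ := h
  refine Submodule.span_le.2 fun v hv => (Submodule.smul_mem_iff _ hα.ne').1 ?_
  refine Submodule.subset_span ⟨?_, ?_⟩
  · convert hC hv.1 hc' hα.le hβ.le hαβ using 1
    module
  · convert hC hv.2 hc' hα.le hβ.le hαβ using 1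
    module

end Algebraic

variable {E : Type*} [NormedAddCommGroup E] [NormedSpace ℝ E] [FiniteDimensional ℝ E]
  {C : Set E} {c : E}

theorem exists_forall_mem_faceDirection_add_mem (hC : Convex ℝ C) (hc : c ∈ C) :
    ∃ r > 0, ∀ v ∈ faceDirection C c, ‖v‖ ≤ r → c + v ∈ C := by
  have hconvex : Convex ℝ {v | c + v ∈ C ∧ c - v ∈ C} := by
    refine (hC.translate_preimage_right c).inter ?_
    simp only [sub_eq_add_neg]
    exact (hC.translate_preimage_right c).linear_preimage (-LinearMap.id : E →ₗ[ℝ] E)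
  obtain ⟨r, hr, h⟩ := exists_forall_mem_span_of_neg_mem hconvex (by simpa using hc)
    fun v hv => by simpa [sub_eq_add_neg, and_comm] using hv
  exact ⟨r, hr, fun v hv hvr => (h v hv hvr).1⟩

theorem exists_mem_openSegment_of_sub_mem_faceDirection (hC : Convex ℝ C) (hc : c ∈ C) {m : E}
    (hm : m - c ∈ faceDirection C c) : ∃ c' ∈ C, c ∈ openSegment ℝ m c' := by
  obtain ⟨r, hr, hball⟩ := exists_forall_mem_faceDirection_add_mem hC hc
  have hsmall : ∀ᶠ t : ℝ in 𝓝[>] 0, ‖(-t) • (m - c)‖ < r := by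
    refine nhdsWithin_le_nhds (ContinuousAt.eventually_lt (by fun_prop) continuousAt_const ?_)
    simpa using hr
  obtain ⟨t, htr, ht : 0 < t⟩ := (hsmall.and self_mem_nhdsWithin).exists
  refine ⟨c + (-t) • (m - c), hball _ (Submodule.smul_mem _ _ hm) htr.le,
    t / (1 + t), 1 / (1 + t), by positivity, by positivity, by field_simp; ring, ?_⟩
  match_scalars <;> field_simp
  ring

theorem map_mem_extremePoints_of_ker_eq_faceDirection {F : Type*} [AddCommGroup F] [Module ℝ F]
    (hC : Convex ℝ C) (hc : c ∈ C) {ℓ : E →ₗ[ℝ] F} (hℓ : LinearMap.ker ℓ = faceDirection C c) :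
    ℓ c ∈ (ℓ '' C).extremePoints ℝ := by
  rw [mem_extremePoints_iff_left]
  refine ⟨mem_image_of_mem ℓ hc, ?_⟩
  rintro _ ⟨p, hp, rfl⟩ _ ⟨q, hq, rfl⟩ ⟨α, β, hα, hβ, hαβ, hsum⟩
  have hmc : α • p + β • q - c ∈ faceDirection C c := by
    rw [← hℓ, LinearMap.sub_mem_ker_iff, ← hsum, map_add, map_smul, map_smul]
  obtain ⟨c', hc', hseg⟩ := exists_mem_openSegment_of_sub_mem_faceDirection hC hc hmc
  have hpq : p - q ∈ faceDirection C c :=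
    faceDirection_le_of_mem_openSegment hC hc' hseg
      (sub_mem_faceDirection_of_mem_openSegment hC hp hq ⟨α, β, hα, hβ, hαβ, rfl⟩)
  rw [← hℓ, LinearMap.sub_mem_ker_iff] at hpq
  rw [← hsum, ← hpq, ← add_smul, hαβ, one_smul]

end Faces

section Transversality

variable {E F G : Type*} [NormedAddCommGroup E] [NormedSpace ℝ E] [NormedAddCommGroup F]
  [NormedSpace ℝ F] [NormedAddCommGroup G] [NormedSpace ℝ G]

theorem eventually_forall_add_mem_of_lowerHemicontinuousWithinAt_fiberOn [ProperSpace E]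
    {C : Set E} (hC : IsClosed C) (hCc : Convex ℝ C) {ℓ : E →L[ℝ] F} {c : E} {r : ℝ} (hr : 0 < r)
    (hball : ∀ v, ℓ v = 0 → ‖v‖ ≤ r → c + v ∈ C)
    (h : LowerHemicontinuousWithinAt (fiberOn ℓ C) (ℓ '' C) (ℓ c)) :
    ∀ᶠ c' in 𝓝[C] c, ∀ v, ℓ v = 0 → ‖v‖ ≤ r / 2 → c' + v ∈ C := by
  let B (ρ : ℝ) : Set E := {v | ℓ v = 0} ∩ closedBall 0 ρ
  have hB (ρ : ℝ) : IsCompact (B ρ) :=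
    (isCompact_closedBall 0 ρ).inter_left (isClosed_eq ℓ.continuous continuous_const)
  have hfiber : (c + ·) '' B r ⊆ fiberOn ℓ C (ℓ c) := by
    rintro _ ⟨v, ⟨hv, hvr⟩, rfl⟩
    exact ⟨hball v hv (mem_closedBall_zero_iff.1 hvr),
      show ℓ (c + v) = ℓ c by rw [map_add, hv, add_zero]⟩
  have hnear : ∀ᶠ c' in 𝓝[C] c, (c + ·) '' B r ⊆ thickening (r / 4) (fiberOn ℓ C (ℓ c')) :=
    (ℓ.continuous.continuousWithinAt.tendsto_nhdsWithin (mapsTo_image ℓ C)).eventually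
      (eventually_subset_thickening_of_lowerHemicontinuousWithinAt h
        ((hB r).image (continuous_const_add c)) hfiber (by positivity))
  filter_upwards [hnear, nhdsWithin_le_nhds (ball_mem_nhds c (by positivity : 0 < r / 4))]
    with c' hsub hc'
  have hadd : B (r / 2) + B (r / 2) ⊆ (c' + ·) ⁻¹' C + B (r / 2) := by
    rintro _ ⟨v, ⟨hv, hvr⟩, w, ⟨hw, hwr⟩, rfl⟩
    have hvw : v + w ∈ B r := by
      refine ⟨show ℓ (v + w) = 0 by rw [map_add, hv, hw, add_zero], ?_⟩
      rw [mem_closedBall_zero_iff] at *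
      linarith [norm_add_le v w]
    obtain ⟨z, ⟨hzC, hz⟩, hdist⟩ := mem_thickening_iff.1 (hsub (mem_image_of_mem _ hvw))
    refine ⟨z - c', by simpa using hzC, v + w - (z - c'), ⟨?_, ?_⟩, add_sub_cancel _ _⟩
    · change ℓ (v + w - (z - c')) = 0
      rw [map_sub, map_sub, show ℓ z = ℓ c' from hz, hvw.1, sub_self, sub_zero]
    · rw [mem_closedBall_zero_iff]
      calc ‖v + w - (z - c')‖ = ‖c + (v + w) - z + (c' - c)‖ := by congr 1; abel
        _ ≤ ‖c + (v + w) - z‖ + ‖c' - c‖ := norm_add_le _ _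
        _ ≤ r / 2 := by
          rw [← dist_eq_norm, ← dist_eq_norm]
          linarith [mem_ball.1 hc']
  have hclosed : IsClosed ((c' + ·) ⁻¹' C) := hC.preimage (continuous_const_add c')
  have hBne : (B (r / 2)).Nonempty := ⟨0, map_zero ℓ, mem_closedBall_self (by positivity)⟩
  have hsubset : B (r / 2) ⊆ (c' + ·) ⁻¹' C :=
    hclosed.closure_eq ▸
      subset_closure_of_add_subset_add (hCc.translate_preimage_right c') (hB _) hBne hadd
  exact fun v hv hvr => hsubset ⟨hv, mem_closedBall_zero_iff.2 hvr⟩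

theorem eventually_eventually_forall_combo_mem {D : Set G} (hD : IsCompact D) {d : G} {N : Set G}
    (hN : N ∈ 𝓝 d) :
    ∀ᶠ t : ℝ in 𝓝 0, ∀ᶠ d₁ in 𝓝 d, ∀ d₂ ∈ D, (1 - t) • d₁ + t • d₂ ∈ N := by
  have hcont : Continuous fun p : (ℝ × G) × G => (1 - p.1.1) • p.1.2 + p.1.1 • p.2 := by fun_prop
  have htube : ∀ᶠ p : ℝ × G in 𝓝 (0, d), ∀ d₂ ∈ D, (1 - p.1) • p.2 + p.1 • d₂ ∈ N :=
    hD.eventually_forall_of_forall_eventually fun d₂ _ =>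
      hcont.continuousAt.eventually_mem (by simpa using hN)
  exact htube.curry_nhds

theorem lowerHemicontinuousWithinAt_fiberOn_of_comp [ProperSpace E] {D : Set G}
    (hD : IsCompact D) (hDc : Convex ℝ D) {σ : G →L[ℝ] E} {ℓ : E →L[ℝ] F} {c : E} {r : ℝ}
    (hr : 0 < r) (hball : ∀ v, ℓ v = 0 → ‖v‖ ≤ r → c + v ∈ σ '' D)
    (h : LowerHemicontinuousWithinAt (fiberOn (ℓ ∘ σ) D) (ℓ ∘ σ '' D) (ℓ c)) :
    LowerHemicontinuousWithinAt (fiberOn σ D) (σ '' D) c := by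
  have himage : LowerHemicontinuousWithinAt (fiberOn ℓ (σ '' D)) (ℓ '' (σ '' D)) (ℓ c) := by
    rw [← image_comp, funext fun y => fiberOn_image (f := σ) (g := ℓ) (s := D) (z := y)]
    exact lowerHemicontinuousWithinAt_image h σ.continuous
  have hball' := eventually_forall_add_mem_of_lowerHemicontinuousWithinAt_fiberOn
    (hD.image σ.continuous).isClosed (hDc.linear_image σ.toLinearMap) hr hball himage
  rw [lowerHemicontinuousWithinAt_iff_forall_mem_nhds] at h ⊢
  rintro d ⟨hd, rfl : σ d = c⟩ N hN
  obtain ⟨t, ht, ht0 : 0 < t, ht1 : t < 1⟩ :=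
    (((eventually_eventually_forall_combo_mem hD hN).filter_mono nhdsWithin_le_nhds).and
      (Ioo_mem_nhdsGT one_pos)).exists
  have hsmall : ∀ᶠ p : E × G in 𝓝 (σ d, d), ‖((1 - t) / t) • (p.1 - σ p.2)‖ < r / 2 := by
    refine ContinuousAt.eventually_lt (by fun_prop) continuousAt_const ?_
    simpa using hr
  obtain ⟨U, hU, V, hV, hUV⟩ := mem_nhds_prod_iff.1 hsmall
  have hlift : ∀ᶠ c' in 𝓝[σ '' D] σ d,
      (fiberOn (ℓ ∘ σ) D (ℓ c') ∩ ({d₁ | ∀ d₂ ∈ D, (1 - t) • d₁ + t • d₂ ∈ N} ∩ V)).Nonempty :=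
    (ℓ.continuous.continuousWithinAt.tendsto_nhdsWithin
      (by rw [image_comp]; exact mapsTo_image ℓ _)).eventually (h d ⟨hd, rfl⟩ _ (inter_mem ht hV))
  filter_upwards [hlift, hball', nhdsWithin_le_nhds hU]
    with c' ⟨d₁, ⟨hd₁, (hℓ : ℓ (σ d₁) = ℓ c')⟩, hN₁, hV₁⟩ hball' hc'U
  have hker : ℓ (((1 - t) / t) • (c' - σ d₁)) = 0 := by
    rw [map_smul, map_sub, hℓ, sub_self, smul_zero]
  -- Extend the segment from `σ d₁` through `c'` by the factor `(1 - t) / t`; it stays in `σ '' D`.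
  obtain ⟨d₂, hd₂, hσ⟩ := hball' _ hker (hUV (mk_mem_prod hc'U hV₁)).le
  refine ⟨(1 - t) • d₁ + t • d₂, ⟨hDc hd₁ hd₂ (by linarith) ht0.le (by ring), ?_⟩, hN₁ d₂ hd₂⟩
  change σ ((1 - t) • d₁ + t • d₂) = c'
  rw [map_add, map_smul, map_smul, hσ]
  match_scalars <;> field_simp <;> ring

end Transversality

section PSets

variable {n : ℕ} {C : Set (EuclideanSpace ℝ (Fin n))} {u x : EuclideanSpace ℝ (Fin n)}

theorem shadow_neg : shadow (-u) C = shadow u C := by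
  simp only [shadow, ← neg_singleton, Submodule.span_neg]

theorem setOf_add_smul_mem_eq_Icc (hC : IsCompact C) (hCc : Convex ℝ C) (hu : ‖u‖ = 1)
    (hx : x ∈ shadow u C) :
    {μ : ℝ | x + μ • u ∈ C} = Icc (lowerBoundary C u x) (-lowerBoundary C (-u) x) := by
  have hmin := isLeast_lowerBoundary hC hu hx
  have hmax := isLeast_lowerBoundary hC ((norm_neg u).trans hu) (shadow_neg.symm ▸ hx)
  have hconvex : Convex ℝ {μ : ℝ | x + μ • u ∈ C} :=
    (hCc.translate_preimage_right x).linear_preimage (LinearMap.toSpanSingleton ℝ _ u)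
  refine Subset.antisymm (fun μ hμ => ⟨hmin.2 hμ, le_neg.2 (hmax.2 ?_)⟩)
    (hconvex.ordConnected.out hmin.1 ?_)
  · simpa using hμ
  · simpa using hmax.1

theorem starProjection_orthogonal_span_singleton_eq_iff {p q : EuclideanSpace ℝ (Fin n)} :
    (Submodule.span ℝ {u})ᗮ.starProjection p = (Submodule.span ℝ {u})ᗮ.starProjection q ↔
      ∃ k : ℝ, k • u = p - q := by
  rw [← sub_eq_zero, ← map_sub, Submodule.starProjection_apply_eq_zero_iff,
    Submodule.orthogonal_orthogonal, Submodule.mem_span_singleton]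

theorem starProjection_orthogonal_add_smul_of_mem_shadow (hx : x ∈ shadow u C) (μ : ℝ) :
    (Submodule.span ℝ {u})ᗮ.starProjection (x + μ • u) = x := by
  obtain ⟨z, -, rfl⟩ := hx
  rw [starProjection_orthogonal_span_singleton_eq_iff.2 ⟨μ, (add_sub_cancel_left _ _).symm⟩]
  exact Submodule.starProjection_eq_self_iff.2 (Submodule.starProjection_apply_mem _ z)

theorem starProjection_orthogonal_add_inner_smul (hu : ‖u‖ = 1) (z : EuclideanSpace ℝ (Fin n)) :
    (Submodule.span ℝ {u})ᗮ.starProjection z + inner ℝ u z • u = z := by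
  rw [add_comm, ← Submodule.starProjection_unit_singleton ℝ hu,
    Submodule.starProjection_add_starProjection_orthogonal]

theorem IsPSet.lowerHemicontinuousOn_fiberOn_starProjection (hC : IsPSet C) (hu : ‖u‖ = 1) :
    LowerHemicontinuousOn (fiberOn (Submodule.span ℝ {u})ᗮ.starProjection C) (shadow u C) := by
  refine fun x hx => lowerHemicontinuousWithinAt_iff_forall_mem_nhds.2 ?_
  rintro z ⟨hz, rfl⟩ N hN
  set P := (Submodule.span ℝ {u})ᗮ.starProjection
  have hIcc {x'} (hx' : x' ∈ shadow u C) := setOf_add_smul_mem_eq_Icc hC.isCompact hC.convex hu hx'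
  let height (x' : EuclideanSpace ℝ (Fin n)) : ℝ :=
    max (lowerBoundary C u x') (min (inner ℝ u z) (-lowerBoundary C (-u) x'))
  have hheight_eq : height (P z) = inner ℝ u z := by
    have hz' : P z + inner ℝ u z • u ∈ C := by rwa [starProjection_orthogonal_add_inner_smul hu]
    obtain ⟨hlow, hhigh⟩ := (hIcc hx).subset hz'
    exact (max_eq_right (le_min hlow (hlow.trans hhigh))).trans (min_eq_left hhigh)
  have hheight_mem : ∀ x' ∈ shadow u C, x' + height x' • u ∈ C := by
    intro x' hx'
    have hle : lowerBoundary C u x' ≤ -lowerBoundary C (-u) x' := by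
      obtain ⟨h₁, h₂⟩ := (hIcc hx').subset (isLeast_lowerBoundary hC.isCompact hu hx').1
      exact h₁.trans h₂
    exact (hIcc hx').superset ⟨le_max_left _ _, max_le hle (min_le_right _ _)⟩
  have hcont : ContinuousWithinAt (fun x' => x' + height x' • u) (shadow u C) (P z) := by
    have hlow := hC.continuousOn_lowerBoundary u hu (P z) hx
    have hhigh := hC.continuousOn_lowerBoundary (-u) ((norm_neg u).trans hu) (P z)
      (shadow_neg.symm ▸ hx)
    rw [shadow_neg] at hhigh
    exact continuousWithinAt_id.add
      ((hlow.max (continuousWithinAt_const.min hhigh.neg)).smul continuousWithinAt_const)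
  have hvalue : P z + height (P z) • u = z := by
    rw [hheight_eq, starProjection_orthogonal_add_inner_smul hu]
  filter_upwards [hcont.eventually_mem (hvalue.symm ▸ hN), self_mem_nhdsWithin] with x' hx'N hx'
  exact ⟨_, ⟨hheight_mem x' hx', starProjection_orthogonal_add_smul_of_mem_shadow hx' _⟩, hx'N⟩

variable {F : Type*} [NormedAddCommGroup F] [NormedSpace ℝ F]

theorem IsPSet.eventually_nonempty_fiberOn_inter (hC : IsPSet C)
    {ℓ : EuclideanSpace ℝ (Fin n) →L[ℝ] F} {p q : EuclideanSpace ℝ (Fin n)} (hp : p ∈ C)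
    (hpq : ℓ p = ℓ q) {N : Set (EuclideanSpace ℝ (Fin n))} (hN : N ∈ 𝓝 p) :
    ∀ᶠ g in 𝓝[C] q, (fiberOn ℓ C (ℓ g) ∩ N).Nonempty := by
  rcases eq_or_ne p q with rfl | hne
  · filter_upwards [self_mem_nhdsWithin, nhdsWithin_le_nhds hN] with g hg hgN
    exact ⟨g, ⟨hg, rfl⟩, hgN⟩
  set u := ‖p - q‖⁻¹ • (p - q)
  have hu : ‖u‖ = 1 := norm_smul_inv_norm (𝕜 := ℝ) (sub_ne_zero.2 hne)
  have hℓu : ℓ u = 0 := by rw [map_smul, map_sub, hpq, sub_self, smul_zero]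
  set P := (Submodule.span ℝ {u})ᗮ.starProjection
  have hP : P p = P q := starProjection_orthogonal_span_singleton_eq_iff.2
    ⟨‖p - q‖, smul_inv_smul₀ (norm_ne_zero_iff.2 (sub_ne_zero.2 hne)) _⟩
  have hfiber : ∀ g, fiberOn P C (P g) ⊆ fiberOn ℓ C (ℓ g) := by
    rintro g z ⟨hz, hzg⟩
    obtain ⟨k, hk⟩ := starProjection_orthogonal_span_singleton_eq_iff.1 hzg
    refine ⟨hz, show ℓ z = ℓ g from sub_eq_zero.1 ?_⟩
    rw [← map_sub, ← hk, map_smul, hℓu, smul_zero]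
  have hline : ∀ᶠ x in 𝓝[shadow u C] P q, (fiberOn P C x ∩ N).Nonempty :=
    hP ▸ lowerHemicontinuousWithinAt_iff_forall_mem_nhds.1
      (hC.lowerHemicontinuousOn_fiberOn_starProjection hu (P p) (mem_image_of_mem _ hp))
      p ⟨hp, rfl⟩ N hN
  have hP_tendsto : Tendsto P (𝓝[C] q) (𝓝[shadow u C] P q) :=
    P.continuous.continuousWithinAt.tendsto_nhdsWithin (mapsTo_image P C)
  filter_upwards [hP_tendsto.eventually hline] with g hg
  exact hg.mono (inter_subset_inter_left N (hfiber g))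

theorem IsPSet.lowerHemicontinuousOn_fiberOn (hC : IsPSet C)
    (ℓ : EuclideanSpace ℝ (Fin n) →L[ℝ] F) : LowerHemicontinuousOn (fiberOn ℓ C) (ℓ '' C) := by
  refine fun y _ => lowerHemicontinuousWithinAt_iff_forall_mem_nhds.2 ?_
  rintro p ⟨hp, hpy⟩ N hN
  have hgood : fiberOn ℓ C y ⊆ interior {g | g ∈ C → (fiberOn ℓ C (ℓ g) ∩ N).Nonempty} :=
    fun q hq => mem_interior_iff_mem_nhds.2
      (eventually_nhdsWithin_iff.1
        (hC.eventually_nonempty_fiberOn_inter hp (hpy.trans hq.2.symm) hN))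
  have hupper := (upperHemicontinuous_fiberOn hC.isCompact hC.isCompact.isClosed
    ℓ.continuous).forall_isOpen y _ isOpen_interior hgood
  filter_upwards [nhdsWithin_le_nhds hupper, self_mem_nhdsWithin] with y' hsub hy'
  obtain ⟨g, hg, rfl⟩ := hy'
  exact interior_subset (hsub ⟨hg, rfl⟩) hg

end PSets

section Sums

section ExtremeFibers

variable {E F : Type*} [NormedAddCommGroup E] [NormedSpace ℝ E] [NormedAddCommGroup F]
  [NormedSpace ℝ F] {A B : Set E} {ℓ : E →L[ℝ] F} {y : F}

theorem fiberOn_map_add_eq_prod_of_mem_extremePoints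
    (hy : y ∈ (ℓ '' (A + B)).extremePoints ℝ) :
    fiberOn (fun d : E × E => ℓ (d.1 + d.2)) (A ×ˢ B) y =
      (Prod.fst '' fiberOn (fun d : E × E => ℓ (d.1 + d.2)) (A ×ˢ B) y) ×ˢ
        (Prod.snd '' fiberOn (fun d : E × E => ℓ (d.1 + d.2)) (A ×ˢ B) y) := by
  refine subset_fst_image_prod_snd_image.antisymm ?_
  rintro ⟨a, b⟩ ⟨⟨⟨a, b'⟩, ⟨⟨ha, hb'⟩, hab'⟩, rfl⟩, ⟨⟨a', b⟩, ⟨⟨ha', hb⟩, ha'b⟩, rfl⟩⟩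
  refine ⟨⟨ha, hb⟩, ?_⟩
  simp only [mem_preimage, mem_singleton_iff, map_add] at *
  rw [image_add, ← ha'b] at hy
  obtain ⟨haa', -⟩ := eq_and_eq_of_add_mem_extremePoints_add (mem_image_of_mem ℓ ha')
    (mem_image_of_mem ℓ ha) (mem_image_of_mem ℓ hb) (mem_image_of_mem ℓ hb') hy
    (hab'.trans ha'b.symm)
  rw [haa', ha'b]

theorem fiberOn_add_eq_image_fiberOn_map_add :
    fiberOn ℓ (A + B) y =
      (fun d : E × E => d.1 + d.2) '' fiberOn (fun d : E × E => ℓ (d.1 + d.2)) (A ×ˢ B) y := by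
  rw [← add_image_prod, fiberOn_image]
  rfl

theorem lowerHemicontinuousWithinAt_fiberOn_map_add_extremePoints (hA : IsCompact A)
    (hAc : Convex ℝ A) (hB : IsCompact B) (hBc : Convex ℝ B)
    (hy : y ∈ (ℓ '' (A + B)).extremePoints ℝ)
    (h : LowerHemicontinuousWithinAt (fiberOn ℓ (A + B)) (ℓ '' (A + B)) y) :
    LowerHemicontinuousWithinAt (fiberOn (fun d : E × E => ℓ (d.1 + d.2)) (A ×ˢ B))
      ((ℓ '' (A + B)).extremePoints ℝ) y := by
  set τ : E × E → F := fun d => ℓ (d.1 + d.2)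
  let Φ (e : F) : Set E := Prod.fst '' fiberOn τ (A ×ˢ B) e
  let Ψ (e : F) : Set E := Prod.snd '' fiberOn τ (A ×ˢ B) e
  have hτ : Continuous τ := by fun_prop
  have hupper := upperHemicontinuous_fiberOn (hA.prod hB) (hA.prod hB).isClosed hτ
  have hcompact : IsCompact (fiberOn τ (A ×ˢ B) y) :=
    (hA.prod hB).inter_right (isClosed_singleton.preimage hτ)
  have hconvex (e : F) : Convex ℝ (fiberOn τ (A ×ˢ B) e) :=
    (hAc.prod hBc).inter ((convex_singleton (𝕜 := ℝ) e).linear_preimage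
      (ℓ.toLinearMap ∘ₗ (LinearMap.fst ℝ E E + LinearMap.snd ℝ E E)))
  have hne : (fiberOn τ (A ×ˢ B) y).Nonempty := by
    obtain ⟨_, ⟨a, ha, b, hb, rfl⟩, hab⟩ := extremePoints_subset hy
    exact ⟨(a, b), ⟨ha, hb⟩, hab⟩
  have hprod : ∀ e ∈ (ℓ '' (A + B)).extremePoints ℝ, fiberOn τ (A ×ˢ B) e = Φ e ×ˢ Ψ e :=
    fun e he => fiberOn_map_add_eq_prod_of_mem_extremePoints he
  have hsum : ∀ e ∈ (ℓ '' (A + B)).extremePoints ℝ, fiberOn ℓ (A + B) e = Φ e + Ψ e := by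
    intro e he
    rw [fiberOn_add_eq_image_fiberOn_map_add, hprod e he, add_image_prod]
  have hsum' : ∀ e ∈ (ℓ '' (A + B)).extremePoints ℝ, fiberOn ℓ (A + B) e = Ψ e + Φ e :=
    fun e he => (hsum e he).trans (add_comm _ _)
  have hlower := h.mono (extremePoints_subset (𝕜 := ℝ))
  have hΦ : LowerHemicontinuousWithinAt Φ ((ℓ '' (A + B)).extremePoints ℝ) y :=
    lowerHemicontinuousWithinAt_of_add hlower
      ((upperHemicontinuous_image hupper continuous_snd).upperHemicontinuousWithinAt _ y)
      (fun e _ => (hconvex e).linear_image (LinearMap.fst ℝ E E))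
      (hcompact.image continuous_snd) (hne.image _) (hsum y hy).ge fun e he => (hsum e he).le
  have hΨ : LowerHemicontinuousWithinAt Ψ ((ℓ '' (A + B)).extremePoints ℝ) y :=
    lowerHemicontinuousWithinAt_of_add hlower
      ((upperHemicontinuous_image hupper continuous_fst).upperHemicontinuousWithinAt _ y)
      (fun e _ => (hconvex e).linear_image (LinearMap.snd ℝ E E))
      (hcompact.image continuous_fst) (hne.image _) (hsum' y hy).ge fun e he => (hsum' e he).le
  exact (lowerHemicontinuousWithinAt_prod hΦ hΨ).congr_of_eventuallyEq hy
    (eventually_nhdsWithin_of_forall fun e he => (hprod e he).symm)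

end ExtremeFibers

variable {E : Type*} [NormedAddCommGroup E] [InnerProductSpace ℝ E] {A B : Set E}

theorem lowerHemicontinuousOn_fiberOn_add [FiniteDimensional ℝ E] (hA : IsCompact A)
    (hAc : Convex ℝ A) (hB : IsCompact B) (hBc : Convex ℝ B)
    (h : ∀ ℓ : E →L[ℝ] E, LowerHemicontinuousOn (fiberOn ℓ (A + B)) (ℓ '' (A + B))) :
    LowerHemicontinuousOn (fiberOn (fun d : E × E => d.1 + d.2) (A ×ˢ B)) (A + B) := by
  intro c hc
  have hC : Convex ℝ (A + B) := hAc.add hBc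
  obtain ⟨r, hr, hball⟩ := exists_forall_mem_faceDirection_add_mem hC hc
  -- Collapsing the face of `c` makes its image extreme.
  let ℓ : E →L[ℝ] E := (faceDirection (A + B) c)ᗮ.starProjection
  have hker (v : E) : ℓ v = 0 ↔ v ∈ faceDirection (A + B) c := by
    rw [Submodule.starProjection_apply_eq_zero_iff, Submodule.orthogonal_orthogonal]
  have hext : ℓ c ∈ (ℓ '' (A + B)).extremePoints ℝ :=
    map_mem_extremePoints_of_ker_eq_faceDirection hC hc (ℓ := ℓ.toLinearMap) (Submodule.ext hker)
  let σ : E × E →L[ℝ] E := .fst ℝ E E + .snd ℝ E E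
  have hσ : σ '' A ×ˢ B = A + B := add_image_prod
  have himage : (ℓ ∘L σ) '' A ×ˢ B = ℓ '' (A + B) := by
    rw [ContinuousLinearMap.coe_comp, image_comp, hσ]
  have hcomp : LowerHemicontinuousWithinAt (fiberOn (ℓ ∘L σ) (A ×ˢ B)) ((ℓ ∘L σ) '' A ×ˢ B)
      (ℓ c) := by
    refine lowerHemicontinuousWithinAt_fiberOn_of_extremePoints (hA.prod hB) (hAc.prod hBc)
      (himage ▸ hext) ?_
    rw [himage, show ⇑(ℓ ∘L σ) = fun d : E × E => ℓ (d.1 + d.2) from rfl]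
    exact lowerHemicontinuousWithinAt_fiberOn_map_add_extremePoints hA hAc hB hBc hext
      (h ℓ (ℓ c) (mem_image_of_mem ℓ hc))
  rw [← hσ, show (fun d : E × E => d.1 + d.2) = σ from rfl]
  rw [ContinuousLinearMap.coe_comp] at hcomp
  exact lowerHemicontinuousWithinAt_fiberOn_of_comp (hA.prod hB) (hAc.prod hBc) hr
    (fun v hv hvr => hσ ▸ hball v ((hker v).1 hv) hvr) hcomp

end Sums

theorem isCompact_of_isCompact_add {E : Type*} [AddGroup E] [TopologicalSpace E]
    [IsTopologicalAddGroup E] {A B : Set E} (hA : IsClosed A) (hB : B.Nonempty)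
    (h : IsCompact (A + B)) : IsCompact A := by
  obtain ⟨b, hb⟩ := hB
  refine (h.image (continuous_sub_right b)).of_isClosed_subset hA fun a ha => ?_
  exact ⟨a + b, add_mem_add ha hb, add_sub_cancel_right a b⟩

theorem exists_continuous_splitting {E : Type*} [NormedAddCommGroup E] [NormedSpace ℝ E]
    [StrictConvexSpace ℝ E] {A B : Set E} (hA : IsCompact A) (hAc : Convex ℝ A)
    (hB : IsCompact B) (hBc : Convex ℝ B)
    (h : LowerHemicontinuousOn (fiberOn (fun d : E × E => d.1 + d.2) (A ×ˢ B)) (A + B)) :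
    ∃ (a : ↥(A + B) → A) (b : ↥(A + B) → B), Continuous a ∧ Continuous b ∧
      ∀ c : ↥(A + B), (a c : E) + (b c : E) = c := by
  set σ : E × E → E := fun d => d.1 + d.2
  have hAB : IsCompact (A ×ˢ B) := hA.prod hB
  have hσ : Continuous σ := continuous_add
  let Φ (c : ↥(A + B)) : Set E := Prod.fst '' fiberOn σ (A ×ˢ B) c
  have hlower : LowerHemicontinuous Φ := fun c =>
    lowerHemicontinuousWithinAt_univ_iff.1 (lowerHemicontinuousWithinAt_image
      (lowerHemicontinuousWithinAt_univ_iff.2 (lowerHemicontinuous_restrict_iff.2 h c))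
      continuous_fst)
  have hupper : UpperHemicontinuous Φ := upperHemicontinuous_image
    ((upperHemicontinuous_fiberOn hAB hAB.isClosed hσ).comp continuous_subtype_val) continuous_fst
  have hcompact (c : ↥(A + B)) : IsCompact (Φ c) :=
    (hAB.inter_right (isClosed_singleton.preimage hσ)).image continuous_fst
  have hconvex (c : ↥(A + B)) : Convex ℝ (Φ c) :=
    ((hAc.prod hBc).inter ((convex_singleton (𝕜 := ℝ) (c : E)).linear_preimage
      (LinearMap.fst ℝ E E + LinearMap.snd ℝ E E))).linear_image (LinearMap.fst ℝ E E)
  have hne (c : ↥(A + B)) : (Φ c).Nonempty := by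
    obtain ⟨a, ha, b, hb, hab⟩ := c.2
    exact ⟨a, (a, b), ⟨⟨ha, hb⟩, hab⟩, rfl⟩
  obtain ⟨a, ha, haΦ⟩ := exists_continuous_selection hlower hupper hcompact hconvex hne
  have hsplit (c : ↥(A + B)) : a c ∈ A ∧ (c : E) - a c ∈ B := by
    obtain ⟨⟨a', b⟩, ⟨⟨ha', hb⟩, hab : a' + b = c⟩, hac : a' = a c⟩ := haΦ c
    rw [← hac, ← hab, add_sub_cancel_left]
    exact ⟨ha', hb⟩
  exact ⟨fun c => ⟨a c, (hsplit c).1⟩, fun c => ⟨c - a c, (hsplit c).2⟩, ha.subtype_mk _,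
    (continuous_subtype_val.sub ha).subtype_mk _, fun c => add_sub_cancel _ _⟩

theorem theorem2 {n : ℕ} (A B C : Set (EuclideanSpace ℝ (Fin n)))
    (hAconv : Convex ℝ A) (hAclosed : IsClosed A)
    (hBconv : Convex ℝ B) (hBclosed : IsClosed B)
    (hC : C = A + B) (hP : IsPSet C) :
    ∃ (a : C → A) (b : C → B), Continuous a ∧ Continuous b ∧
      ∀ c : C, (a c : EuclideanSpace ℝ (Fin n)) + (b c : EuclideanSpace ℝ (Fin n)) = c := by
  subst hC
  rcases (A + B).eq_empty_or_nonempty with hempty | hne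
  · have : IsEmpty ↥(A + B) := isEmpty_coe_sort.2 hempty
    exact ⟨isEmptyElim, isEmptyElim, continuous_of_const isEmptyElim,
      continuous_of_const isEmptyElim, isEmptyElim⟩
  obtain ⟨hAne, hBne⟩ := add_nonempty.1 hne
  have hA : IsCompact A := isCompact_of_isCompact_add hAclosed hBne hP.isCompact
  have hB : IsCompact B :=
    isCompact_of_isCompact_add hBclosed hAne (add_comm A B ▸ hP.isCompact)
  have hfiber : LowerHemicontinuousOn
      (fiberOn (fun d : _ × EuclideanSpace ℝ (Fin n) => d.1 + d.2) (A ×ˢ B)) (A + B) :=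
    lowerHemicontinuousOn_fiberOn_add hA hAconv hB hBconv hP.lowerHemicontinuousOn_fiberOn
  exact exists_continuous_splitting hA hAconv hB hBconv hfiber
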